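/- Let $\pi_1<\pi_2<\cdots$ be the points of a unit rate Poisson process on the positive half-line (that is, with $\pi_0=0$, the gaps $\pi_j-\pi_{j-1}$, $j\ge 1$, are independent and exponentially distributed with rate $1$). For real $t\ge 0$ define the exit count and the entrance count $$N(t)=\max\{n\ge 1:\ \pi_1+\cdots+\pi_n\le t\},\qquad M(t)=\max\{n\ge 1:\ n\pi_n-(\pi_1+\cdots+\pi_{n-1})\le t\},$$ where $\max\varnothing=0$. Then, almost surely, the two sets are finite for all $t$, so that $N(t)$ and $M(t)$ are well defined, and, as $t\to\infty$: 1. almost surely $N(t)\sim\sqrt{2t}$ and almost surely $M(t)\sim\sqrt{2t}$, that is, $N(t)/\sqrt{2t}\to 1$ and $M(t)/\sqrt{2t}\to 1$; 2. $N(t)$ and $M(t)$ are both asymptotically normal ${\rm AN}\left(\sqrt{2t},\tfrac13\sqrt{2t}\right)$, that is, the random variables $$\frac{N(t)-\sqrt{2t}}{\left(\tfrac13\sqrt{2t}\right)^{1/2}}\qquad\text{and}\qquad\frac{M(t)-\sqrt{2t}}{\left(\tfrac13\sqrt{2t}\right)^{1/2}}$$ each converge in distribution to the standard normal law. -/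

import Mathlib

open MeasureTheory ProbabilityTheory Filter Topology Asymptotics

noncomputable section

namespace Shuttle

/-- `π 1, π 2, …` are the successive points of a unit rate Poisson process on the positive
half-line: with the convention `π 0 = 0`, the gaps `π 1 - π 0, π 2 - π 1, …` are independent
exponential random variables of rate one. -/
structure IsUnitPoissonPoints {Ω : Type*} [MeasurableSpace Ω] (μ : Measure Ω)
    (π : ℕ → Ω → ℝ) : Prop where
  measurable : ∀ n, Measurable (π n)
  zero : ∀ ω, π 0 ω = 0
  indep_gaps : iIndepFun (fun (j : ℕ) (ω : Ω) => π (j + 1) ω - π j ω) μ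
  law_gaps : ∀ j : ℕ, HasLaw (fun ω => π (j + 1) ω - π j ω) (expMeasure 1) μ

/-- The exit count `N(t) = max {n ≥ 1 : π 1 + ⋯ + π n ≤ t}`, with `max ∅ = 0`
(the supremum in `ℕ` of the empty set is `0`). -/
def exitCount {Ω : Type*} (π : ℕ → Ω → ℝ) (t : ℝ) (ω : Ω) : ℕ :=
  sSup {n : ℕ | 1 ≤ n ∧ ∑ j ∈ Finset.Icc 1 n, π j ω ≤ t}

/-- The entrance count `M(t) = max {n ≥ 1 : n π n - (π 1 + ⋯ + π (n - 1)) ≤ t}`,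
with `max ∅ = 0`. -/
def entranceCount {Ω : Type*} (π : ℕ → Ω → ℝ) (t : ℝ) (ω : Ω) : ℕ :=
  sSup {n : ℕ | 1 ≤ n ∧ (n : ℝ) * π n ω - ∑ j ∈ Finset.Ico 1 n, π j ω ≤ t}

/-- `X t` is `AN(m t, v t)` as `t → ∞`: the standardized variables
`(X t - m t) / √(v t)` converge in distribution to a standard normal variable. -/
def IsAsymptoticallyNormal {Ω : Type*} [MeasurableSpace Ω] (μ : Measure Ω)
    [IsProbabilityMeasure μ] (X : ℝ → Ω → ℝ) (m v : ℝ → ℝ) : Prop :=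
  TendstoInDistribution (fun (t : ℝ) (ω : Ω) => (X t ω - m t) / √(v t)) atTop
    (id : ℝ → ℝ) (fun _ => μ) (gaussianReal 0 1)

end Shuttle

end

/-!
The `k`-th gap of the process (`k ≥ 0`) is contained in each of the points `π (k + 1), …, π n`.
Hence the exit time `S n = π 1 + ⋯ + π n` is the sum of the first `n` gaps with weights
`n, n - 1, …, 1` (`exitTime_eq_sum_gaps`), and the entrance time
`T n = n π n - (π 1 + ⋯ + π (n - 1))` is their sum with weights `1, 2, …, n`
(`entranceTime_eq_sum_gaps`). Both sequences are almost surely nondecreasing, and `N(t)`, `M(t)`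
are their inverses, in the sense of `lastIndex`.

*Almost sure behaviour.* The strong law gives `π n / n → 1`, so summation gives `S n / n² → 1 / 2`
and `T n / n² → 1 / 2`. A sequence growing like `n² / 2` has finite sublevel sets and an inverse
equivalent to `√(2t)` (`lastIndex_isEquivalent`).

*Asymptotic normality.* Both `S n` and `T n` have mean `n (n + 1) / 2` and variance
`1² + ⋯ + n² ~ n³ / 3`. A central limit theorem for weighted sums of independent identically
distributed variables (`tendstoInDistribution_weighted_sum`), proved by comparing characteristic
functions factor by factor, shows that both are asymptotically normal. This is transferred to the
inverses in `isAsymptoticallyNormal_lastIndex`: the event that the standardized count is at most `x`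
is `{N(t) < k} = {t < S k}`, where `k` is the least natural number exceeding `s + x √(s / 3)` and
`s = √(2t)`; and `t = s² / 2`, standardized with the mean and variance of `S k`, tends to `-x`
(`tendsto_standardized_threshold`). So the distribution functions converge to that of the standard
normal law, by the symmetry of the latter.
-/

noncomputable section

namespace Shuttle

/-! ### A central limit theorem for weighted sums -/

lemma norm_prod_sub_prod_le_sum {ι : Type*} (s : Finset ι) (a b : ι → ℂ)
    (ha : ∀ i ∈ s, ‖a i‖ ≤ 1) (hb : ∀ i ∈ s, ‖b i‖ ≤ 1) :
    ‖∏ i ∈ s, a i - ∏ i ∈ s, b i‖ ≤ ∑ i ∈ s, ‖a i - b i‖ := by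
  classical
  induction s using Finset.induction_on with
  | empty => simp
  | insert i s hi ih =>
    rw [Finset.prod_insert hi, Finset.prod_insert hi, Finset.sum_insert hi]
    have ih' := ih (fun j hj => ha j (Finset.mem_insert_of_mem hj))
      (fun j hj => hb j (Finset.mem_insert_of_mem hj))
    have hprod : ‖∏ j ∈ s, a j‖ ≤ 1 := by
      rw [norm_prod]
      exact Finset.prod_le_one (fun _ _ => norm_nonneg _)
        (fun j hj => ha j (Finset.mem_insert_of_mem hj))
    calc ‖a i * ∏ j ∈ s, a j - b i * ∏ j ∈ s, b j‖
        = ‖(a i - b i) * ∏ j ∈ s, a j + b i * (∏ j ∈ s, a j - ∏ j ∈ s, b j)‖ := by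
          congr 1; ring
      _ ≤ ‖a i - b i‖ * ‖∏ j ∈ s, a j‖ + ‖b i‖ * ‖∏ j ∈ s, a j - ∏ j ∈ s, b j‖ := by
          rw [← norm_mul, ← norm_mul]; exact norm_add_le _ _
      _ ≤ ‖a i - b i‖ * 1 + 1 * ∑ j ∈ s, ‖a j - b j‖ := by
          gcongr
          exact hb i (Finset.mem_insert_self i s)
      _ = _ := by ring

section WeightedCLT

variable {Ω Ω' : Type*} {mΩ : MeasurableSpace Ω} {mΩ' : MeasurableSpace Ω'}
  {P : Measure Ω} {P' : Measure Ω'} [IsProbabilityMeasure P] [IsProbabilityMeasure P']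

/-- The characteristic function of a standardized variable agrees with that of the standard normal
law to second order at the origin. -/
lemma charFun_sub_gaussian_isLittleO {X : Ω → ℝ} (hX : AEMeasurable X P)
    (h0 : P[X] = 0) (h1 : P[X ^ 2] = 1) :
    (fun u : ℝ => charFun (P.map X) u - Complex.exp (-(u : ℂ) ^ 2 / 2)) =o[𝓝 0]
      fun u : ℝ => u ^ 2 := by
  have hexp : (fun u : ℝ => Complex.exp (-(u : ℂ) ^ 2 / 2) - (1 - (u : ℂ) ^ 2 / 2)) =o[𝓝 0]
      fun u : ℝ => u ^ 2 := by
    have h := (Complex.hasDerivAt_exp 0).isLittleO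
    have hlim : Tendsto (fun u : ℝ => -(u : ℂ) ^ 2 / 2) (𝓝 0) (𝓝 0) := by
      have : Continuous (fun u : ℝ => -(u : ℂ) ^ 2 / 2) := by fun_prop
      simpa using this.tendsto 0
    have h' := h.comp_tendsto hlim
    refine (h'.trans_isBigO (k := fun u : ℝ => u ^ 2) ?_).congr_left ?_
    · refine IsBigO.of_bound 1 (Eventually.of_forall fun u => ?_)
      simp only [Function.comp, sub_zero, norm_div, norm_neg, norm_pow, Complex.norm_real,
        Complex.norm_ofNat]
      nlinarith [sq_nonneg ‖u‖]
    · intro u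
      simp only [Function.comp, Complex.exp_zero, sub_zero, smul_eq_mul, mul_one]
      ring
  refine ((taylor_charFun_two hX h0 h1).sub hexp).congr_left fun u => ?_
  ring

/-- **Central limit theorem for weighted sums**: if the `X k` are independent and identically
distributed, centered and with variance `1`, and the weights of the `n`-th sum are uniformly small
with squares summing to `1` in the limit, then the weighted sums are asymptotically standard
normal. -/
theorem tendstoInDistribution_weighted_sum {X : ℕ → Ω → ℝ} {Y : Ω' → ℝ}
    (hY : HasLaw Y (gaussianReal 0 1) P')
    (h0 : P[X 0] = 0) (h1 : P[X 0 ^ 2] = 1) (hindep : iIndepFun X P)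
    (hident : ∀ i, IdentDistrib (X i) (X 0) P P) {w : ℕ → ℕ → ℝ} {δ : ℕ → ℝ}
    (hδ : Tendsto δ atTop (𝓝 0)) (hwδ : ∀ n, ∀ k ∈ Finset.range n, |w n k| ≤ δ n)
    (hw : Tendsto (fun n => ∑ k ∈ Finset.range n, w n k ^ 2) atTop (𝓝 1)) :
    TendstoInDistribution (fun (n : ℕ) ω => ∑ k ∈ Finset.range n, w n k * X k ω) atTop Y
      (fun _ => P) P' where
  forall_aemeasurable n :=
    Finset.aemeasurable_fun_sum _ fun k _ => (hident k).aemeasurable_fst.const_mul _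
  tendsto := by
    have mX (k : ℕ) : AEMeasurable (X k) P := (hident k).aemeasurable_fst
    have : IsProbabilityMeasure (P.map (X 0)) := Measure.isProbabilityMeasure_map (mX 0)
    refine ProbabilityMeasure.tendsto_iff_tendsto_charFun.2 fun t => ?_
    rw! [hY.map_eq]
    set φ : ℝ → ℂ := charFun (P.map (X 0))
    have hchar (n : ℕ) : charFun (P.map fun ω => ∑ k ∈ Finset.range n, w n k * X k ω) t =
        ∏ k ∈ Finset.range n, φ (w n k * t) := by
      have hi : iIndepFun (fun k ω => w n k * X k ω) P :=
        hindep.comp (fun k x => w n k * x) (fun k => by fun_prop)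
      rw [(hi.restrict _).charFun_map_fun_finsetSum_eq_prod fun k _ => (mX k).const_mul _,
        Finset.prod_apply]
      refine Finset.prod_congr rfl fun k _ => ?_
      rw [charFun_map_mul_comp (mX k), (hident k).map_eq]
    have hgauss (n : ℕ) : ∏ k ∈ Finset.range n, Complex.exp (-((w n k * t : ℝ) : ℂ) ^ 2 / 2) =
        Complex.exp (-((((∑ k ∈ Finset.range n, w n k ^ 2) * t ^ 2 / 2 : ℝ)) : ℂ)) := by
      rw [← Complex.exp_sum]
      congr 1
      push_cast
      rw [Finset.sum_mul, Finset.sum_div, ← Finset.sum_neg_distrib]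
      refine Finset.sum_congr rfl fun k _ => ?_
      ring
    have hlim : Tendsto
        (fun n => ∏ k ∈ Finset.range n, Complex.exp (-((w n k * t : ℝ) : ℂ) ^ 2 / 2)) atTop
        (𝓝 (charFun (gaussianReal 0 1) t)) := by
      simp_rw [hgauss, charFun_gaussianReal]
      have hc : Continuous fun x : ℝ => Complex.exp (-((x * t ^ 2 / 2 : ℝ) : ℂ)) := by fun_prop
      convert! (hc.tendsto 1).comp hw using 2
      push_cast
      simp
    -- Each factor differs from its Gaussian counterpart by `o((w n k * t) ^ 2)`, uniformly in `k`;
    -- as `∑ k, w n k ^ 2` stays bounded, the sum of these errors tends to `0`.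
    have hdiff : Tendsto (fun n => ∏ k ∈ Finset.range n, φ (w n k * t) -
        ∏ k ∈ Finset.range n, Complex.exp (-((w n k * t : ℝ) : ℂ) ^ 2 / 2)) atTop (𝓝 0) := by
      have hsum : Tendsto (fun n => ∑ k ∈ Finset.range n,
          ‖φ (w n k * t) - Complex.exp (-((w n k * t : ℝ) : ℂ) ^ 2 / 2)‖) atTop (𝓝 0) := by
        rw [Metric.tendsto_atTop']
        intro ε hε
        -- Eventually `∑ k, w n k ^ 2 < 2`; `t ^ 2 + 1` avoids a division by zero at `t = 0`.
        have hη : 0 < ε / (2 * (t ^ 2 + 1)) := by positivity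
        obtain ⟨r, hr, hr'⟩ := Metric.eventually_nhds_iff.1
          ((charFun_sub_gaussian_isLittleO (mX 0) h0 h1).bound hη)
        have hsmall : ∀ᶠ n in atTop, δ n * |t| < r := by
          have := hδ.mul_const |t|
          rw [zero_mul] at this
          exact this.eventually_lt_const hr
        have hsq : ∀ᶠ n in atTop, ∑ k ∈ Finset.range n, w n k ^ 2 < 2 :=
          hw.eventually_lt_const one_lt_two
        obtain ⟨N, hN⟩ := eventually_atTop.1 (hsmall.and hsq)
        refine ⟨N, fun n hn => ?_⟩
        obtain ⟨hn1, hn2⟩ := hN n hn.le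
        rw [Real.dist_eq, sub_zero, abs_of_nonneg (Finset.sum_nonneg fun _ _ => norm_nonneg _)]
        calc _ ≤ ∑ k ∈ Finset.range n, ε / (2 * (t ^ 2 + 1)) * (w n k * t) ^ 2 := by
              refine Finset.sum_le_sum fun k hk => ?_
              have hk' : dist (w n k * t) 0 < r := by
                rw [Real.dist_eq, sub_zero, abs_mul]
                exact (mul_le_mul_of_nonneg_right (hwδ n k hk) (abs_nonneg t)).trans_lt hn1
              have hb := hr' hk'
              rwa [Real.norm_eq_abs, abs_of_nonneg (sq_nonneg _)] at hb
          _ = ε / (2 * (t ^ 2 + 1)) * t ^ 2 * ∑ k ∈ Finset.range n, w n k ^ 2 := by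
              rw [Finset.mul_sum]
              refine Finset.sum_congr rfl fun k _ => ?_
              ring
          _ ≤ ε / (2 * (t ^ 2 + 1)) * t ^ 2 * 2 := by gcongr
          _ < ε := by
              rw [div_mul_eq_mul_div, div_mul_eq_mul_div, div_lt_iff₀ (by positivity)]
              nlinarith
      refine squeeze_zero_norm (fun n => ?_) hsum
      refine norm_prod_sub_prod_le_sum _ _ _ (fun k _ => norm_charFun_le_one _) fun k _ => ?_
      rw [Complex.norm_exp, Real.exp_le_one_iff]
      have : (-((w n k * t : ℝ) : ℂ) ^ 2 / 2).re = -((w n k * t) ^ 2 / 2) := by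
        rw [show (-((w n k * t : ℝ) : ℂ) ^ 2 / 2) = ((-((w n k * t) ^ 2 / 2) : ℝ) : ℂ) by
          push_cast; ring]
        exact Complex.ofReal_re _
      rw [this]
      have := sq_nonneg (w n k * t)
      linarith
    have := hdiff.add hlim
    simp only [sub_add_cancel, zero_add] at this
    exact this.congr fun n => (hchar n).symm

end WeightedCLT
/-! ### Inverting a sequence of real numbers -/

/-- The last index `n ≥ 1` at which the sequence `a` is at most `t`. It is `0` if there is no such
index, and also if there are infinitely many. -/
def lastIndex (a : ℕ → ℝ) (t : ℝ) : ℕ := sSup {n : ℕ | 1 ≤ n ∧ a n ≤ t}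

lemma finite_setOf_le_of_tendsto_atTop {a : ℕ → ℝ} (ha : Tendsto a atTop atTop) (t : ℝ) :
    {n : ℕ | 1 ≤ n ∧ a n ≤ t}.Finite := by
  obtain ⟨N, hN⟩ := eventually_atTop.1 (ha.eventually_gt_atTop t)
  refine (Set.finite_lt_nat N).subset fun n hn => ?_
  by_contra h
  exact (hN n (not_lt.1 h)).not_ge hn.2

lemma le_lastIndex {a : ℕ → ℝ} (ha : Tendsto a atTop atTop) {t : ℝ} {n : ℕ} (hn : 1 ≤ n)
    (h : a n ≤ t) : n ≤ lastIndex a t :=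
  le_csSup (finite_setOf_le_of_tendsto_atTop ha t).bddAbove ⟨hn, h⟩

lemma lastIndex_le_of_pos {a : ℕ → ℝ} (ha : Tendsto a atTop atTop) {t : ℝ}
    (h : 1 ≤ lastIndex a t) : a (lastIndex a t) ≤ t := by
  have hne : {n : ℕ | 1 ≤ n ∧ a n ≤ t}.Nonempty := by
    by_contra hne
    rw [Set.not_nonempty_iff_eq_empty] at hne
    simp [lastIndex, hne] at h
  exact (Nat.sSup_mem hne (finite_setOf_le_of_tendsto_atTop ha t).bddAbove).2

lemma lt_of_lastIndex_lt {a : ℕ → ℝ} (ha : Tendsto a atTop atTop) {t : ℝ} {n : ℕ}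
    (h : lastIndex a t < n) : t < a n := by
  by_contra h'
  exact h.not_ge (le_lastIndex ha (by omega) (not_lt.1 h'))

lemma lastIndex_lt_iff {a : ℕ → ℝ} (hmono : Monotone a) (ha : Tendsto a atTop atTop)
    {t : ℝ} {n : ℕ} (hn : 1 ≤ n) : lastIndex a t < n ↔ t < a n := by
  refine ⟨lt_of_lastIndex_lt ha, fun h => ?_⟩
  by_contra h'
  rw [not_lt] at h'
  exact (h.trans_le (hmono h')).not_ge (lastIndex_le_of_pos ha (hn.trans h'))

lemma tendsto_lastIndex_atTop {a : ℕ → ℝ} (ha : Tendsto a atTop atTop) :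
    Tendsto (lastIndex a) atTop atTop := by
  refine tendsto_atTop.2 fun n => ?_
  filter_upwards [eventually_ge_atTop (a (n + 1))] with t ht
  exact (Nat.le_succ n).trans (le_lastIndex ha (by omega) ht)

lemma tendsto_atTop_of_tendsto_div_sq {a : ℕ → ℝ}
    (h : Tendsto (fun n : ℕ => a n / (n : ℝ) ^ 2) atTop (𝓝 (1 / 2))) : Tendsto a atTop atTop := by
  have hsq : Tendsto (fun n : ℕ => (n : ℝ) ^ 2) atTop atTop :=
    (tendsto_pow_atTop two_ne_zero).comp tendsto_natCast_atTop_atTop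
  refine (h.pos_mul_atTop (by norm_num) hsq).congr' ?_
  filter_upwards [eventually_gt_atTop 0] with n hn
  have : (n : ℝ) ≠ 0 := by positivity
  field_simp

/-- A sequence growing like `n² / 2` is inverted by `t ↦ √(2t)`: the last index `N` satisfies
`a N ≤ t < a (N + 1)`, so that `t / N²` is squeezed to `1 / 2`. -/
lemma lastIndex_isEquivalent {a : ℕ → ℝ}
    (h : Tendsto (fun n : ℕ => a n / (n : ℝ) ^ 2) atTop (𝓝 (1 / 2))) :
    (fun t : ℝ => (lastIndex a t : ℝ)) ~[atTop] fun t => √(2 * t) := by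
  have ha := tendsto_atTop_of_tendsto_div_sq h
  have hN := tendsto_lastIndex_atTop ha
  have hlow : Tendsto (fun t => a (lastIndex a t) / (lastIndex a t : ℝ) ^ 2) atTop (𝓝 (1 / 2)) :=
    h.comp hN
  have hup0 : Tendsto (fun n : ℕ => a (n + 1) / (n : ℝ) ^ 2) atTop (𝓝 (1 / 2)) := by
    have h1 : Tendsto (fun n : ℕ => a (n + 1) / ((n + 1 : ℕ) : ℝ) ^ 2) atTop (𝓝 (1 / 2)) :=
      (tendsto_add_atTop_iff_nat (f := fun n : ℕ => a n / (n : ℝ) ^ 2) 1).2 h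
    have h2 : Tendsto (fun n : ℕ => (1 + 1 / (n : ℝ)) ^ 2) atTop (𝓝 1) := by
      simpa using ((tendsto_const_nhds (x := (1 : ℝ))).add
        (tendsto_const_div_atTop_nhds_zero_nat (1 : ℝ))).pow 2
    have h3 := h1.mul h2
    rw [mul_one] at h3
    refine h3.congr' ?_
    filter_upwards [eventually_gt_atTop 0] with n hn
    have : (n : ℝ) ≠ 0 := by positivity
    have : ((n + 1 : ℕ) : ℝ) ≠ 0 := by positivity
    push_cast at *
    field_simp
  have hup : Tendsto (fun t => a (lastIndex a t + 1) / (lastIndex a t : ℝ) ^ 2) atTop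
      (𝓝 (1 / 2)) := hup0.comp hN
  have hmid : Tendsto (fun t : ℝ => t / (lastIndex a t : ℝ) ^ 2) atTop (𝓝 (1 / 2)) := by
    refine tendsto_of_tendsto_of_tendsto_of_le_of_le' hlow hup ?_ ?_
    · filter_upwards [hN.eventually_ge_atTop 1] with t ht
      have := lastIndex_le_of_pos ha ht
      gcongr
    · filter_upwards with t
      have := (lt_of_lastIndex_lt ha (Nat.lt_succ_self (lastIndex a t))).le
      gcongr
  have hsqrt : Tendsto (fun t : ℝ => √(2 * (t / (lastIndex a t : ℝ) ^ 2))) atTop (𝓝 1) := by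
    have := (hmid.const_mul 2).sqrt
    simpa using this
  refine IsEquivalent.symm (isEquivalent_of_tendsto_one ?_)
  refine hsqrt.congr' ?_
  filter_upwards with t
  rw [Pi.div_apply, ← mul_div_assoc, Real.sqrt_div' _ (sq_nonneg _), Real.sqrt_sq (by positivity)]

/-- No boundedness is needed: an unbounded set of natural numbers has supremum `0`, which agrees
with the value of the supremum of functions used in the proof. -/
lemma measurable_lastIndex {Ω : Type*} [MeasurableSpace Ω] {A : ℕ → Ω → ℝ}
    (hA : ∀ n, Measurable (A n)) (t : ℝ) : Measurable fun ω => lastIndex (fun n => A n ω) t := by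
  classical
  have h : (fun ω => lastIndex (fun n => A n ω) t) =
      fun ω => ⨆ n : ℕ, if 1 ≤ n ∧ A n ω ≤ t then n else 0 := by
    funext ω
    set S : Set ℕ := {n : ℕ | 1 ≤ n ∧ A n ω ≤ t} with hS
    have hrange : Set.range (fun n : ℕ => if 1 ≤ n ∧ A n ω ≤ t then n else 0) = insert 0 S := by
      ext m
      simp only [Set.mem_range, Set.mem_insert_iff, hS, Set.mem_ofPred_eq]
      constructor
      · rintro ⟨n, rfl⟩
        split_ifs with hn
        · exact Or.inr hn
        · exact Or.inl rfl
      · rintro (rfl | hm)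
        · exact ⟨0, by simp⟩
        · exact ⟨m, if_pos hm⟩
    change sSup S = sSup _
    rw [hrange]
    by_cases hb : BddAbove S
    · rcases S.eq_empty_or_nonempty with he | hne
      · simp [he]
      · rw [csSup_insert hb hne]; simp
    · rw [Nat.sSup_of_not_bddAbove hb, Nat.sSup_of_not_bddAbove]
      rwa [bddAbove_insert]
  rw [h]
  refine Measurable.iSup fun n => ?_
  refine Measurable.ite ?_ measurable_const measurable_const
  exact (MeasurableSet.const _).inter (measurableSet_le (hA n) measurable_const)

/-! ### Convergence of distribution functions -/

/-- Pointwise convergence of distribution functions implies weak convergence. -/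
lemma tendsto_probabilityMeasure_of_tendsto_measureReal_Iic {ι : Type*} {l : Filter ι}
    [l.IsCountablyGenerated] {μ : ι → ProbabilityMeasure ℝ} {ν : ProbabilityMeasure ℝ}
    (h : ∀ x : ℝ, Tendsto (fun i => (μ i : Measure ℝ).real (Set.Iic x)) l
      (𝓝 ((ν : Measure ℝ).real (Set.Iic x)))) : Tendsto μ l (𝓝 ν) := by
  refine (isPiSystem_Ioc (id : ℝ → ℝ) id).tendsto_probabilityMeasure_of_tendsto_of_mem ?_ ?_ ?_
  · rintro s ⟨a, b, -, rfl⟩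
    exact measurableSet_Ioc
  · intro u hu x hx
    obtain ⟨ε, hε, hball⟩ := Metric.isOpen_iff.1 hu x hx
    refine ⟨Set.Ioc (x - ε / 2) (x + ε / 2), ⟨x - ε / 2, x + ε / 2, by simp; linarith, rfl⟩,
      Ioc_mem_nhds (by linarith) (by linarith), fun y hy => hball ?_⟩
    rw [Metric.mem_ball, Real.dist_eq, abs_lt]
    constructor <;> linarith [hy.1, hy.2]
  · rintro s ⟨a, b, hab, rfl⟩
    have hsub (ρ : ProbabilityMeasure ℝ) : ((ρ (Set.Ioc (id a) (id b)) : NNReal) : ℝ) =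
        (ρ : Measure ℝ).real (Set.Iic b) - (ρ : Measure ℝ).real (Set.Iic a) := by
      rw [← ProbabilityMeasure.measureReal_eq_coe_coeFn, ← Set.Iic_sdiff_Iic]
      exact measureReal_sdiff (Set.Iic_subset_Iic.2 hab.le) measurableSet_Iic
    rw [← NNReal.tendsto_coe]
    simp_rw [hsub]
    exact (h b).sub (h a)

/-! ### Inverting a central limit theorem -/

/-- The least natural number exceeding `s + x √(s / 3)`, the level `x` of the standardized count
when `s = √(2t)`. (If the level is negative, the floor is `0` and the index is `1`.) -/
def thresholdIndex (x s : ℝ) : ℕ := ⌊s + x * √(1 / 3 * s)⌋₊ + 1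

lemma tendsto_sqrt_third_mul_atTop : Tendsto (fun s : ℝ => √(1 / 3 * s)) atTop atTop :=
  Real.tendsto_sqrt_atTop.comp (tendsto_id.const_mul_atTop (by norm_num))

lemma eventually_level_nonneg (x : ℝ) : ∀ᶠ s : ℝ in atTop, 0 ≤ s + x * √(1 / 3 * s) := by
  filter_upwards [tendsto_sqrt_third_mul_atTop.eventually_ge_atTop (-x), eventually_ge_atTop 0]
    with s h1 hs
  have h2 : √(1 / 3 * s) ^ 2 = 1 / 3 * s := Real.sq_sqrt (by positivity)
  have h3 := Real.sqrt_nonneg (1 / 3 * s)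
  nlinarith

lemma tendsto_thresholdIndex_sub_div (x : ℝ) :
    Tendsto (fun s : ℝ => ((thresholdIndex x s : ℝ) - s) / √(1 / 3 * s)) atTop (𝓝 x) := by
  have hup : Tendsto (fun s : ℝ => x + 1 / √(1 / 3 * s)) atTop (𝓝 x) := by
    simpa using (tendsto_const_nhds (x := x)).add
      (tendsto_sqrt_third_mul_atTop.const_div_atTop 1)
  refine tendsto_of_tendsto_of_tendsto_of_le_of_le' tendsto_const_nhds hup ?_ ?_
  · filter_upwards [eventually_gt_atTop 0] with s hs
    have hσ : 0 < √(1 / 3 * s) := Real.sqrt_pos.2 (by positivity)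
    rw [le_div_iff₀ hσ, thresholdIndex]
    have := Nat.lt_floor_add_one (s + x * √(1 / 3 * s))
    push_cast
    linarith
  · filter_upwards [eventually_gt_atTop 0, eventually_level_nonneg x] with s hs hx
    have hσ : 0 < √(1 / 3 * s) := Real.sqrt_pos.2 (by positivity)
    rw [div_le_iff₀ hσ, add_mul, div_mul_cancel₀ _ hσ.ne', thresholdIndex]
    have := Nat.floor_le hx
    push_cast
    linarith

lemma tendsto_thresholdIndex_div (x : ℝ) :
    Tendsto (fun s : ℝ => (thresholdIndex x s : ℝ) / s) atTop (𝓝 1) := by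
  have h := ((tendsto_thresholdIndex_sub_div x).mul
    (tendsto_sqrt_third_mul_atTop.const_div_atTop (1 / 3))).const_add 1
  rw [mul_zero, add_zero] at h
  refine h.congr' ?_
  filter_upwards [eventually_gt_atTop 0] with s hs
  have hσ : 0 < √(1 / 3 * s) := Real.sqrt_pos.2 (by positivity)
  have h2 : √(1 / 3 * s) ^ 2 = 1 / 3 * s := Real.sq_sqrt (by positivity)
  have h3 : s = 3 * √(1 / 3 * s) ^ 2 := by rw [h2]; ring
  rw [div_mul_div_comm, ← sq, h2]
  field_simp
  ring

lemma tendsto_thresholdIndex_atTop (x : ℝ) : Tendsto (thresholdIndex x) atTop atTop := by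
  rw [← tendsto_natCast_atTop_iff (R := ℝ)]
  refine ((tendsto_thresholdIndex_div x).pos_mul_atTop one_pos tendsto_id).congr' ?_
  filter_upwards [eventually_gt_atTop 0] with s hs
  simp [hs.ne']

/-- With `k = thresholdIndex x s`, the value `t = s² / 2` lies `x` standard deviations
`√(k³ / 3)` below the mean `k (k + 1) / 2`, up to a vanishing error. -/
lemma tendsto_standardized_threshold (x : ℝ) :
    Tendsto (fun s : ℝ => (s ^ 2 / 2 - thresholdIndex x s * (thresholdIndex x s + 1) / 2) /
      √((thresholdIndex x s : ℝ) ^ 3 / 3)) atTop (𝓝 (-x)) := by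
  have hd := tendsto_thresholdIndex_sub_div x
  have hr := tendsto_thresholdIndex_div x
  have h3 : Tendsto (fun s : ℝ => √(((thresholdIndex x s : ℝ) / s) ^ 3)) atTop (𝓝 1) := by
    simpa using (hr.pow 3).sqrt
  -- With `σ = √(s / 3)` and `q = √((k / s)³)` the ratio is
  -- `-((k - s) / σ * ((1 + k / s) / 2) + k / s / 2 * (1 / σ)) / q`.
  have h := (((hd.mul ((hr.const_add 1).div_const 2)).add
    ((hr.div_const 2).mul (tendsto_sqrt_third_mul_atTop.const_div_atTop 1))).div h3 one_ne_zero).neg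
  have hx : -((x * ((1 + 1) / 2) + 1 / 2 * 0) / 1) = -x := by ring
  rw [hx] at h
  refine h.congr' ?_
  filter_upwards [eventually_gt_atTop 0] with s hs
  have hσ : 0 < √(1 / 3 * s) := Real.sqrt_pos.2 (by positivity)
  have hk : 0 < (thresholdIndex x s : ℝ) := by simp only [thresholdIndex]; positivity
  set k : ℝ := (thresholdIndex x s : ℝ)
  have hsplit : √(k ^ 3 / 3) = √(1 / 3 * s) * s * √((k / s) ^ 3) := by
    rw [show k ^ 3 / 3 = (1 / 3 * s) * s ^ 2 * (k / s) ^ 3 by field_simp,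
      Real.sqrt_mul (by positivity), Real.sqrt_mul (by positivity), Real.sqrt_sq hs.le]
  have hq : 0 < √((k / s) ^ 3) := Real.sqrt_pos.2 (by positivity)
  rw [hsplit]
  simp only [Pi.div_apply]
  generalize √((k / s) ^ 3) = q at *
  generalize √(1 / 3 * s) = σ at *
  field_simp
  ring

section InverseCLT

variable {Ω : Type*} [MeasurableSpace Ω] {μ : Measure Ω}

lemma tendstoInMeasure_const_of_tendsto {ι : Type*} {l : Filter ι} {y : ι → ℝ} {c : ℝ}
    (h : Tendsto y l (𝓝 c)) : TendstoInMeasure μ (fun i (_ : Ω) => y i) l fun _ => c := by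
  intro ε hε
  refine tendsto_const_nhds.congr' ?_
  filter_upwards [(tendsto_iff_edist_tendsto_0.1 h).eventually_lt_const hε] with i hi
  simp [not_le.2 hi]

variable [IsProbabilityMeasure μ]

/-- If `Z i` converges in distribution to a standard normal variable and `y i → -x`, then
`P(y i < Z i)` converges to the standard normal distribution function at `x`. -/
lemma tendsto_measureReal_lt_of_tendstoInDistribution {ι : Type*} {l : Filter ι}
    [l.IsCountablyGenerated] {Z : ι → Ω → ℝ} {y : ι → ℝ} {x : ℝ}
    (hZ : TendstoInDistribution Z l (id : ℝ → ℝ) (fun _ => μ) (gaussianReal 0 1))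
    (hy : Tendsto y l (𝓝 (-x))) :
    Tendsto (fun i => μ.real {ω | y i < Z i ω}) l
      (𝓝 ((gaussianReal 0 1).real (Set.Iic x))) := by
  have hsum := hZ.add_of_tendstoInMeasure_const (Y := fun i (_ : Ω) => -y i) (c := x)
    (tendstoInMeasure_const_of_tendsto (by simpa using hy.neg)) (fun _ => by fun_prop)
  have hmap : (gaussianReal 0 1).map (fun z : ℝ => id z + x) = gaussianReal x 1 := by
    simpa using gaussianReal_map_add_const (μ := 0) (v := 1) x
  have hnull : ((gaussianReal 0 1).map (fun z : ℝ => id z + x)) (frontier (Set.Ioi 0)) = 0 := by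
    have := nullSingletonClass_gaussianReal (μ := x) (v := 1) one_ne_zero
    rw [hmap, frontier_Ioi]
    exact measure_singleton 0
  have hlim := ProbabilityMeasure.tendsto_measure_of_null_frontier_of_tendsto' hsum.tendsto hnull
  -- By symmetry of the normal law, `P(Z + x > 0) = P(Z < x) = P(Z ≤ x)`.
  have hval : ((gaussianReal 0 1).map (fun z : ℝ => id z + x)) (Set.Ioi 0) =
      gaussianReal 0 1 (Set.Iic x) := by
    have := nullSingletonClass_gaussianReal (μ := 0) (v := 1) one_ne_zero
    have hneg : (gaussianReal 0 1).map (fun z : ℝ => -z) = gaussianReal 0 1 := by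
      simpa using gaussianReal_map_neg (μ := 0) (v := 1)
    rw [Measure.map_apply (by fun_prop) measurableSet_Ioi, ← measure_congr Iio_ae_eq_Iic]
    conv_rhs => rw [← hneg, Measure.map_apply (by fun_prop) measurableSet_Iio]
    congr 1
    ext z
    simp only [Set.mem_preimage, Set.mem_Ioi, Set.mem_Iio, id]
    constructor <;> intro h <;> linarith
  simp only [ProbabilityMeasure.coe_mk] at hlim
  rw [hval] at hlim
  refine ((ENNReal.tendsto_toReal (measure_ne_top _ _)).comp hlim).congr fun i => ?_
  rw [Function.comp_apply, Measure.map_apply_of_aemeasurable (hsum.forall_aemeasurable i)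
    measurableSet_Ioi]
  congr 2
  ext ω
  simp

/-- If `A` is almost surely nondecreasing and unbounded, and `A n` is asymptotically normal with
mean `n (n + 1) / 2` and variance `n³ / 3`, then its inverse `lastIndex` is asymptotically normal.
The two laws are linked by `{lastIndex A t < k} = {t < A k}`. -/
theorem isAsymptoticallyNormal_lastIndex {A : ℕ → Ω → ℝ} (hA : ∀ n, Measurable (A n))
    (hmono : ∀ᵐ ω ∂μ, Monotone fun n => A n ω)
    (htop : ∀ᵐ ω ∂μ, Tendsto (fun n => A n ω) atTop atTop)
    (hclt : TendstoInDistribution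
      (fun (n : ℕ) ω => (A n ω - n * (n + 1) / 2) / √((n : ℝ) ^ 3 / 3)) atTop
      (id : ℝ → ℝ) (fun _ => μ) (gaussianReal 0 1)) :
    IsAsymptoticallyNormal μ (fun t ω => (lastIndex (fun n => A n ω) t : ℝ))
      (fun t => √(2 * t)) (fun t => (1 / 3) * √(2 * t)) := by
  have hmeas (t : ℝ) : Measurable fun ω =>
      ((lastIndex (fun n => A n ω) t : ℝ) - √(2 * t)) / √((1 / 3) * √(2 * t)) :=
    ((measurable_from_top.comp (measurable_lastIndex hA t)).sub_const _).div_const _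
  refine ⟨fun t => (hmeas t).aemeasurable, aemeasurable_id, ?_⟩
  refine tendsto_probabilityMeasure_of_tendsto_measureReal_Iic fun x => ?_
  simp only [ProbabilityMeasure.coe_mk, Measure.map_id]
  have hs : Tendsto (fun t : ℝ => √(2 * t)) atTop atTop :=
    Real.tendsto_sqrt_atTop.comp (tendsto_id.const_mul_atTop two_pos)
  have hk : Tendsto (fun t : ℝ => thresholdIndex x √(2 * t)) atTop atTop :=
    (tendsto_thresholdIndex_atTop x).comp hs
  have hZ : TendstoInDistribution (fun (t : ℝ) ω => (A (thresholdIndex x √(2 * t)) ω -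
        thresholdIndex x √(2 * t) * (thresholdIndex x √(2 * t) + 1) / 2) /
        √((thresholdIndex x √(2 * t) : ℝ) ^ 3 / 3)) atTop
      (id : ℝ → ℝ) (fun _ => μ) (gaussianReal 0 1) :=
    ⟨fun t => hclt.forall_aemeasurable _, aemeasurable_id, hclt.tendsto.comp hk⟩
  have h := tendsto_measureReal_lt_of_tendstoInDistribution hZ
    ((tendsto_standardized_threshold x).comp hs)
  refine h.congr' ?_
  filter_upwards [hs.eventually (eventually_level_nonneg x), eventually_gt_atTop 0] with t hx ht
  rw [map_measureReal_apply (hmeas t) measurableSet_Iic]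
  refine measureReal_congr ?_
  filter_upwards [hmono, htop] with ω hω hω'
  have hspos : 0 < √(2 * t) := Real.sqrt_pos.2 (by positivity)
  have hσ : 0 < √(1 / 3 * √(2 * t)) := Real.sqrt_pos.2 (by positivity)
  have hkpos : 0 < (thresholdIndex x √(2 * t) : ℝ) := by
    simp only [thresholdIndex]; positivity
  have hden : 0 < √((thresholdIndex x √(2 * t) : ℝ) ^ 3 / 3) := Real.sqrt_pos.2 (by positivity)
  refine propext ?_
  change (_ < _) ↔ ((lastIndex (fun n => A n ω) t : ℝ) - √(2 * t)) / √(1 / 3 * √(2 * t)) ≤ x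
  rw [Function.comp_apply, div_lt_div_iff_of_pos_right hden, sub_lt_sub_iff_right,
    Real.sq_sqrt (by positivity), mul_div_cancel_left₀ _ two_ne_zero,
    ← lastIndex_lt_iff hω hω' (by simp [thresholdIndex]), thresholdIndex, Nat.lt_succ_iff,
    Nat.le_floor_iff hx, div_le_iff₀ hσ, sub_le_iff_le_add']

end InverseCLT

/-! ### Moments of the exponential distribution -/

lemma integral_pow_expMeasure_one (k : ℕ) : ∫ x, x ^ k ∂(expMeasure 1) = (k.factorial : ℝ) := by
  have hpdf : expMeasure 1 = volume.withDensity fun x => ENNReal.ofReal (exponentialPDFReal 1 x) :=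
    rfl
  rw [hpdf, integral_withDensity_eq_integral_toReal_smul (by fun_prop)
    (ae_of_all _ fun _ => ENNReal.ofReal_lt_top)]
  -- The point `0` has to be excluded: the density is one there, while the indicator vanishes.
  have hind : (fun x : ℝ => (ENNReal.ofReal (exponentialPDFReal 1 x)).toReal • x ^ k) =ᵐ[volume]
      (Set.Ioi (0 : ℝ)).indicator fun x => x ^ ((k + 1 : ℝ) - 1) * Real.exp (-(1 * x)) := by
    filter_upwards [Measure.ae_ne volume (0 : ℝ)] with x hx
    rw [ENNReal.toReal_ofReal (exponentialPDFReal_nonneg one_pos x)]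
    rcases lt_or_gt_of_ne hx with h | h
    · rw [Set.indicator_of_notMem (by simpa using h.le)]
      simp [exponentialPDFReal, gammaPDFReal, not_le.2 h]
    · rw [Set.indicator_of_mem (by simpa using h)]
      simp [exponentialPDFReal, gammaPDFReal, h.le, mul_comm]
  rw [integral_congr_ae hind, integral_indicator measurableSet_Ioi,
    Real.integral_rpow_mul_exp_neg_mul_Ioi (by positivity) one_pos, Real.Gamma_nat_eq_factorial]
  simp

/-- The Bochner integral of a non-integrable function is zero, so a nonzero moment is finite. -/
lemma integrable_pow_expMeasure_one (k : ℕ) : Integrable (fun x : ℝ => x ^ k) (expMeasure 1) :=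
  .of_integral_ne_zero (by rw [integral_pow_expMeasure_one]; positivity)

lemma ae_nonneg_expMeasure_one : ∀ᵐ x ∂(expMeasure 1), 0 ≤ x := by
  rw [ae_iff]
  have : {x : ℝ | ¬ 0 ≤ x} = Set.Iio 0 := by ext; simp
  rw [this, expMeasure, gammaMeasure, withDensity_apply _ measurableSet_Iio]
  exact lintegral_gammaPDF_of_nonpos le_rfl

/-! ### The weights `1, …, n` -/

lemma sum_range_succ_sq (n : ℕ) :
    ∑ k ∈ Finset.range n, ((k : ℝ) + 1) ^ 2 = (n : ℝ) * (n + 1) * (2 * n + 1) / 6 := by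
  induction n with
  | zero => simp
  | succ n ih => rw [Finset.sum_range_succ, ih]; push_cast; ring

lemma sum_range_succ_cast (n : ℕ) :
    ∑ k ∈ Finset.range n, ((k : ℝ) + 1) = n * (n + 1) / 2 := by
  induction n with
  | zero => simp
  | succ n ih => rw [Finset.sum_range_succ, ih]; push_cast; ring

lemma sum_range_sub_eq {M : Type*} [AddCommMonoid M] (f : ℝ → M) (n : ℕ) :
    ∑ k ∈ Finset.range n, f ((n : ℝ) - k) = ∑ k ∈ Finset.range n, f ((k : ℝ) + 1) := by
  rw [← Finset.sum_range_reflect]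
  refine Finset.sum_congr rfl fun k hk => ?_
  have hk' : k < n := Finset.mem_range.1 hk
  congr 1
  rw [Nat.sub_sub, Nat.cast_sub (by omega)]
  push_cast
  ring

lemma tendsto_sum_sq_weights :
    Tendsto (fun n : ℕ => ∑ k ∈ Finset.range n, (((k : ℝ) + 1) / √((n : ℝ) ^ 3 / 3)) ^ 2)
      atTop (𝓝 1) := by
  have h0 := tendsto_const_div_atTop_nhds_zero_nat (1 : ℝ)
  have h : Tendsto (fun n : ℕ => (1 + 1 / (n : ℝ)) * (1 + 1 / 2 * (1 / (n : ℝ)))) atTop (𝓝 1) := by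
    simpa only [add_zero, mul_zero, mul_one] using
      (h0.const_add 1).mul ((h0.const_mul (1 / 2)).const_add 1)
  refine h.congr' ?_
  filter_upwards [eventually_gt_atTop 0] with n hn
  have hn' : (n : ℝ) ≠ 0 := by positivity
  simp_rw [div_pow, Real.sq_sqrt (show (0 : ℝ) ≤ (n : ℝ) ^ 3 / 3 by positivity)]
  rw [← Finset.sum_div, sum_range_succ_sq]
  field_simp
  ring

lemma tendsto_max_weight :
    Tendsto (fun n : ℕ => (n : ℝ) / √((n : ℝ) ^ 3 / 3)) atTop (𝓝 0) := by
  have h : Tendsto (fun n : ℕ => √(3 / (n : ℝ))) atTop (𝓝 0) := by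
    simpa using (tendsto_const_div_atTop_nhds_zero_nat (3 : ℝ)).sqrt
  refine h.congr' ?_
  filter_upwards [eventually_gt_atTop 0] with n hn
  have hn' : 0 < (n : ℝ) := by positivity
  rw [eq_div_iff (Real.sqrt_pos.2 (by positivity)).ne', ← Real.sqrt_mul (by positivity),
    Real.sqrt_eq_iff_mul_self_eq (by positivity) hn'.le]
  field_simp

/-! ### Exit and entrance times -/

/-- The `n`-th exit time `π 1 + ⋯ + π n`; the exit count is its `lastIndex`. -/
def exitTime {Ω : Type*} (π : ℕ → Ω → ℝ) (n : ℕ) (ω : Ω) : ℝ := ∑ j ∈ Finset.Icc 1 n, π j ω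

/-- The `n`-th entrance time `n π n - (π 1 + ⋯ + π (n - 1))`; the entrance count is its
`lastIndex`. -/
def entranceTime {Ω : Type*} (π : ℕ → Ω → ℝ) (n : ℕ) (ω : Ω) : ℝ :=
  n * π n ω - ∑ j ∈ Finset.Ico 1 n, π j ω

section Algebra

variable {Ω : Type*} {π : ℕ → Ω → ℝ}

lemma exitTime_succ (n : ℕ) (ω : Ω) : exitTime π (n + 1) ω = exitTime π n ω + π (n + 1) ω :=
  Finset.sum_Icc_succ_top (by omega) _

lemma entranceTime_succ_eq (n : ℕ) (ω : Ω) :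
    entranceTime π (n + 1) ω = (n + 1) * π (n + 1) ω - exitTime π n ω := by
  rw [entranceTime, exitTime, Nat.cast_succ]
  rfl

lemma entranceTime_succ (h0 : ∀ ω, π 0 ω = 0) (n : ℕ) (ω : Ω) :
    entranceTime π (n + 1) ω = entranceTime π n ω + (n + 1) * (π (n + 1) ω - π n ω) := by
  cases n with
  | zero => simp [entranceTime, h0]
  | succ n =>
    rw [entranceTime_succ_eq, entranceTime_succ_eq, exitTime_succ]
    push_cast
    ring

lemma sum_gaps (h0 : ∀ ω, π 0 ω = 0) (n : ℕ) (ω : Ω) :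
    ∑ k ∈ Finset.range n, (π (k + 1) ω - π k ω) = π n ω := by
  rw [Finset.sum_range_sub (fun k => π k ω), h0, sub_zero]

/-- The exit time weights the successive gaps by `n, …, 1`: the gap after `π k` is contained in
`π (k + 1), …, π n`. -/
lemma exitTime_eq_sum_gaps (h0 : ∀ ω, π 0 ω = 0) (n : ℕ) (ω : Ω) :
    exitTime π n ω = ∑ k ∈ Finset.range n, ((n : ℝ) - k) * (π (k + 1) ω - π k ω) := by
  induction n with
  | zero => simp [exitTime]
  | succ n ih =>
    have hgaps := sum_gaps h0 (n + 1) ω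
    have hsplit : ∑ k ∈ Finset.range (n + 1), (((n + 1 : ℕ) : ℝ) - k) * (π (k + 1) ω - π k ω) =
        ∑ k ∈ Finset.range (n + 1), ((n : ℝ) - k) * (π (k + 1) ω - π k ω) +
          ∑ k ∈ Finset.range (n + 1), (π (k + 1) ω - π k ω) := by
      rw [← Finset.sum_add_distrib]
      refine Finset.sum_congr rfl fun k _ => ?_
      push_cast
      ring
    rw [hsplit, hgaps, Finset.sum_range_succ, sub_self, zero_mul, add_zero, exitTime_succ, ih]

/-- The entrance time weights the successive gaps by `1, …, n`, the weights of the exit time in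
reverse order. -/
lemma entranceTime_eq_sum_gaps (h0 : ∀ ω, π 0 ω = 0) (n : ℕ) (ω : Ω) :
    entranceTime π n ω = ∑ k ∈ Finset.range n, ((k : ℝ) + 1) * (π (k + 1) ω - π k ω) := by
  induction n with
  | zero => simp [entranceTime]
  | succ n ih => rw [entranceTime_succ h0, ih, Finset.sum_range_succ]

end Algebra

/-! ### Poisson points: monotonicity, moments and the law of large numbers -/

section PoissonPoints

variable {Ω : Type*} [MeasurableSpace Ω] {μ : Measure Ω} {π : ℕ → Ω → ℝ}

lemma measurable_exitTime (hπ : IsUnitPoissonPoints μ π) (n : ℕ) : Measurable (exitTime π n) :=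
  Finset.measurable_fun_sum _ fun j _ => hπ.measurable j

lemma measurable_entranceTime (hπ : IsUnitPoissonPoints μ π) (n : ℕ) :
    Measurable (entranceTime π n) :=
  ((hπ.measurable n).const_mul _).sub (Finset.measurable_fun_sum _ fun j _ => hπ.measurable j)

lemma ae_gaps_nonneg (hπ : IsUnitPoissonPoints μ π) :
    ∀ᵐ ω ∂μ, ∀ j, 0 ≤ π (j + 1) ω - π j ω := by
  refine ae_all_iff.2 fun j => ?_
  have h := ae_nonneg_expMeasure_one
  rw [← (hπ.law_gaps j).map_eq] at h
  exact ae_of_ae_map (hπ.law_gaps j).aemeasurable h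

lemma ae_monotone_exitTime (hπ : IsUnitPoissonPoints μ π) :
    ∀ᵐ ω ∂μ, Monotone fun n => exitTime π n ω := by
  filter_upwards [ae_gaps_nonneg hπ] with ω hω
  refine monotone_nat_of_le_succ fun n => ?_
  rw [exitTime_succ, ← sum_gaps hπ.zero (n + 1)]
  exact le_add_of_nonneg_right (Finset.sum_nonneg fun k _ => hω k)

lemma ae_monotone_entranceTime (hπ : IsUnitPoissonPoints μ π) :
    ∀ᵐ ω ∂μ, Monotone fun n => entranceTime π n ω := by
  filter_upwards [ae_gaps_nonneg hπ] with ω hω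
  refine monotone_nat_of_le_succ fun n => ?_
  rw [entranceTime_succ hπ.zero]
  exact le_add_of_nonneg_right (mul_nonneg (by positivity) (hω n))

lemma identDistrib_gaps (hπ : IsUnitPoissonPoints μ π) (i j : ℕ) :
    IdentDistrib (fun ω => π (i + 1) ω - π i ω) (fun ω => π (j + 1) ω - π j ω) μ μ :=
  ⟨(hπ.law_gaps i).aemeasurable, (hπ.law_gaps j).aemeasurable,
    (hπ.law_gaps i).map_eq.trans (hπ.law_gaps j).map_eq.symm⟩

lemma integrable_gap_pow (hπ : IsUnitPoissonPoints μ π) (j k : ℕ) :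
    Integrable (fun ω => (π (j + 1) ω - π j ω) ^ k) μ := by
  have h := integrable_pow_expMeasure_one k
  rw [← (hπ.law_gaps j).map_eq] at h
  exact h.comp_aemeasurable (hπ.law_gaps j).aemeasurable

lemma integral_gap_pow (hπ : IsUnitPoissonPoints μ π) (j k : ℕ) :
    ∫ ω, (π (j + 1) ω - π j ω) ^ k ∂μ = (k.factorial : ℝ) := by
  rw [← integral_pow_expMeasure_one k, ← (hπ.law_gaps j).map_eq,
    integral_map (hπ.law_gaps j).aemeasurable (by fun_prop)]

/-- The strong law of large numbers for the gaps, in terms of the points. -/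
lemma ae_tendsto_points_div (hπ : IsUnitPoissonPoints μ π) :
    ∀ᵐ ω ∂μ, Tendsto (fun n : ℕ => π n ω / n) atTop (𝓝 1) := by
  have h := strong_law_ae_real (fun j ω => π (j + 1) ω - π j ω)
    (by simpa using integrable_gap_pow hπ 0 1)
    (fun i j hij => hπ.indep_gaps.indepFun hij) (fun i => identDistrib_gaps hπ i 0)
  have h1 : ∫ ω, (π (0 + 1) ω - π 0 ω) ∂μ = 1 := by simpa using integral_gap_pow hπ 0 1
  filter_upwards [h] with ω hω
  rw [h1] at hω
  simpa only [sum_gaps hπ.zero] using hω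

/-- If `a n / n → 1` then the partial sums of `a` grow like `n² / 2`. -/
lemma tendsto_sum_div_sq {a : ℕ → ℝ} (h : Tendsto (fun n : ℕ => a n / n) atTop (𝓝 1)) :
    Tendsto (fun n : ℕ => (∑ j ∈ Finset.Icc 1 n, a j) / (n : ℝ) ^ 2) atTop (𝓝 (1 / 2)) := by
  have ho : (fun n : ℕ => a (n + 1) - (n + 1 : ℝ)) =o[atTop] fun n : ℕ => (n + 1 : ℝ) := by
    refine isLittleO_of_tendsto (fun n hn => absurd hn (by positivity)) ?_
    have h' := ((tendsto_add_atTop_iff_nat (f := fun n : ℕ => a n / n) 1).2 h).sub_const 1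
    rw [sub_self] at h'
    refine h'.congr fun n => ?_
    have : (n + 1 : ℝ) ≠ 0 := by positivity
    push_cast
    field_simp
  have h0 := tendsto_const_div_atTop_nhds_zero_nat (1 : ℝ)
  have hsq : Tendsto (fun n : ℕ => (n * (n + 1) / 2 : ℝ) / (n : ℝ) ^ 2) atTop (𝓝 (1 / 2)) := by
    have := (h0.const_add 1).mul_const (1 / 2)
    rw [add_zero, one_mul] at this
    refine this.congr' ?_
    filter_upwards [eventually_gt_atTop 0] with n hn
    have : (n : ℝ) ≠ 0 := by positivity
    field_simp
  have htop : Tendsto (fun n : ℕ => ∑ i ∈ Finset.range n, ((i : ℝ) + 1)) atTop atTop := by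
    simp_rw [sum_range_succ_cast]
    exact tendsto_atTop_of_tendsto_div_sq hsq
  have hs := ho.sum_range (fun n => by positivity) htop
  simp_rw [sum_range_succ_cast, Finset.sum_sub_distrib, sum_range_succ_cast] at hs
  have hlim := (hs.tendsto_div_nhds_zero.mul hsq).add hsq
  rw [zero_mul, zero_add] at hlim
  refine hlim.congr' ?_
  filter_upwards [eventually_gt_atTop 0] with n hn
  have hn' : (n : ℝ) ≠ 0 := by positivity
  have hn1 : (n : ℝ) + 1 ≠ 0 := by positivity
  have hsum : ∑ j ∈ Finset.Icc 1 n, a j = ∑ i ∈ Finset.range n, a (i + 1) := by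
    rw [Finset.range_eq_Ico, Finset.sum_Ico_add' a 0 n 1]
    rfl
  rw [hsum]
  field_simp
  ring

lemma ae_tendsto_exitTime_div_sq (hπ : IsUnitPoissonPoints μ π) :
    ∀ᵐ ω ∂μ, Tendsto (fun n : ℕ => exitTime π n ω / (n : ℝ) ^ 2) atTop (𝓝 (1 / 2)) := by
  filter_upwards [ae_tendsto_points_div hπ] with ω hω
  exact tendsto_sum_div_sq hω

lemma ae_tendsto_entranceTime_div_sq (hπ : IsUnitPoissonPoints μ π) :
    ∀ᵐ ω ∂μ, Tendsto (fun n : ℕ => entranceTime π n ω / (n : ℝ) ^ 2) atTop (𝓝 (1 / 2)) := by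
  filter_upwards [ae_tendsto_points_div hπ] with ω hω
  have h1 : Tendsto (fun n : ℕ => ((n : ℝ) + 1) / n * (π n ω / n)) atTop (𝓝 1) := by
    have h0 := (tendsto_const_div_atTop_nhds_zero_nat (1 : ℝ)).const_add 1
    have := h0.mul hω
    rw [add_zero, one_mul] at this
    refine this.congr' ?_
    filter_upwards [eventually_gt_atTop 0] with n hn
    have : (n : ℝ) ≠ 0 := by positivity
    field_simp
  have h := h1.sub (tendsto_sum_div_sq hω)
  rw [show (1 : ℝ) - 1 / 2 = 1 / 2 by norm_num] at h
  refine h.congr' ?_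
  filter_upwards [eventually_gt_atTop 0] with n hn
  obtain ⟨m, rfl⟩ : ∃ m, n = m + 1 := ⟨n - 1, by omega⟩
  have hm : ((m + 1 : ℕ) : ℝ) ≠ 0 := by positivity
  rw [entranceTime_succ_eq]
  change _ - exitTime π (m + 1) ω / _ = _
  rw [exitTime_succ]
  push_cast at *
  field_simp
  ring

/-! ### Asymptotic normality of the counts -/

variable [IsProbabilityMeasure μ]

/-- The central limit theorem for weighted sums of the gaps, the weights of the `n`-th sum being
`1, …, n` in some order. That they are a rearrangement of `1, …, n` is expressed by `hc`: sums of a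
function over them agree. -/
lemma tendstoInDistribution_weighted_gaps (hπ : IsUnitPoissonPoints μ π) {c : ℕ → ℕ → ℝ}
    (hc : ∀ (f : ℝ → ℝ) (n : ℕ),
      ∑ k ∈ Finset.range n, f (c n k) = ∑ k ∈ Finset.range n, f ((k : ℝ) + 1))
    (hcn : ∀ n, ∀ k ∈ Finset.range n, |c n k| ≤ n) :
    TendstoInDistribution (fun (n : ℕ) ω =>
      ((∑ k ∈ Finset.range n, c n k * (π (k + 1) ω - π k ω)) - n * (n + 1) / 2) /
        √((n : ℝ) ^ 3 / 3)) atTop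
      (id : ℝ → ℝ) (fun _ => μ) (gaussianReal 0 1) := by
  have i1 : Integrable (fun ω => π (0 + 1) ω - π 0 ω) μ := by
    simpa using integrable_gap_pow hπ 0 1
  have m1 : ∫ ω, (π (0 + 1) ω - π 0 ω) ∂μ = 1 := by simpa using integral_gap_pow hπ 0 1
  have i2 := integrable_gap_pow hπ 0 2
  have m2 := integral_gap_pow hπ 0 2
  have i3 : Integrable (fun ω => 2 * (π (0 + 1) ω - π 0 ω) - 1) μ :=
    (i1.const_mul 2).sub (integrable_const _)
  have h := tendstoInDistribution_weighted_sum (P := μ) (P' := gaussianReal 0 1)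
    (Y := (id : ℝ → ℝ)) (X := fun k ω => (π (k + 1) ω - π k ω) - 1) HasLaw.id
    (by rw [integral_sub i1 (integrable_const _), m1]; simp)
    (by
      have hsq : ((fun ω => (π (0 + 1) ω - π 0 ω) - 1) ^ 2 : Ω → ℝ) =
          fun ω => (π (0 + 1) ω - π 0 ω) ^ 2 - (2 * (π (0 + 1) ω - π 0 ω) - 1) := by
        funext ω
        simp only [Pi.pow_apply]
        ring
      rw [hsq, integral_sub i2 i3,
        integral_sub (i1.const_mul 2) (integrable_const _), integral_const_mul, m1, m2]
      norm_num)
    (hπ.indep_gaps.comp (fun _ x => x - 1) (fun _ => by fun_prop))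
    (fun i => (identDistrib_gaps hπ i 0).comp (u := fun x => x - 1) (by fun_prop))
    (w := fun n k => c n k / √((n : ℝ) ^ 3 / 3))
    tendsto_max_weight
    (fun n k hk => by
      rw [abs_div, abs_of_nonneg (Real.sqrt_nonneg _)]
      exact div_le_div_of_nonneg_right (hcn n k hk) (Real.sqrt_nonneg _))
    (by
      refine tendsto_sum_sq_weights.congr fun n => ?_
      exact (hc (fun x => (x / √((n : ℝ) ^ 3 / 3)) ^ 2) n).symm)
  convert! h using 3 with n ω
  rw [← sum_range_succ_cast, ← hc (fun x => x) n, ← Finset.sum_sub_distrib, Finset.sum_div]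
  refine Finset.sum_congr rfl fun k _ => ?_
  ring

lemma isAsymptoticallyNormal_exitCount (hπ : IsUnitPoissonPoints μ π) :
    IsAsymptoticallyNormal μ (fun t ω => (exitCount π t ω : ℝ))
      (fun t => √(2 * t)) (fun t => (1 / 3) * √(2 * t)) := by
  refine isAsymptoticallyNormal_lastIndex (A := exitTime π) (measurable_exitTime hπ)
    (ae_monotone_exitTime hπ)
    ((ae_tendsto_exitTime_div_sq hπ).mono fun ω => tendsto_atTop_of_tendsto_div_sq) ?_
  simp_rw [exitTime_eq_sum_gaps hπ.zero]
  refine tendstoInDistribution_weighted_gaps hπ (c := fun n k => (n : ℝ) - k)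
    (fun f n => sum_range_sub_eq f n) fun n k hk => ?_
  have hk' : (k : ℝ) ≤ n := by exact_mod_cast (Finset.mem_range.1 hk).le
  rw [abs_of_nonneg (by linarith)]
  linarith [(Nat.cast_nonneg k : (0 : ℝ) ≤ k)]

lemma isAsymptoticallyNormal_entranceCount (hπ : IsUnitPoissonPoints μ π) :
    IsAsymptoticallyNormal μ (fun t ω => (entranceCount π t ω : ℝ))
      (fun t => √(2 * t)) (fun t => (1 / 3) * √(2 * t)) := by
  refine isAsymptoticallyNormal_lastIndex (A := entranceTime π) (measurable_entranceTime hπ)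
    (ae_monotone_entranceTime hπ)
    ((ae_tendsto_entranceTime_div_sq hπ).mono fun ω => tendsto_atTop_of_tendsto_div_sq) ?_
  simp_rw [entranceTime_eq_sum_gaps hπ.zero]
  refine tendstoInDistribution_weighted_gaps hπ (c := fun _ k => (k : ℝ) + 1)
    (fun f n => rfl) fun n k hk => ?_
  rw [abs_of_nonneg (by positivity)]
  exact_mod_cast Finset.mem_range.1 hk

end PoissonPoints

end Shuttle

end

theorem mainTheorem4 {Ω : Type*} [MeasurableSpace Ω] (μ : Measure Ω) [IsProbabilityMeasure μ]
    (π : ℕ → Ω → ℝ) (hπ : Shuttle.IsUnitPoissonPoints μ π) :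
    (∀ᵐ ω ∂μ, (∀ t : ℝ,
        {n : ℕ | 1 ≤ n ∧ ∑ j ∈ Finset.Icc 1 n, π j ω ≤ t}.Finite ∧
        {n : ℕ | 1 ≤ n ∧ (n : ℝ) * π n ω - ∑ j ∈ Finset.Ico 1 n, π j ω ≤ t}.Finite)) ∧
    (∀ᵐ ω ∂μ,
      (fun t : ℝ => (Shuttle.exitCount π t ω : ℝ)) ~[atTop] (fun t : ℝ => √(2 * t))) ∧
    (∀ᵐ ω ∂μ,
      (fun t : ℝ => (Shuttle.entranceCount π t ω : ℝ)) ~[atTop] (fun t : ℝ => √(2 * t))) ∧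
    Shuttle.IsAsymptoticallyNormal μ (fun t ω => (Shuttle.exitCount π t ω : ℝ))
      (fun t => √(2 * t)) (fun t => (1 / 3) * √(2 * t)) ∧
    Shuttle.IsAsymptoticallyNormal μ (fun t ω => (Shuttle.entranceCount π t ω : ℝ))
      (fun t => √(2 * t)) (fun t => (1 / 3) * √(2 * t)) := by
  have hS := Shuttle.ae_tendsto_exitTime_div_sq hπ
  have hT := Shuttle.ae_tendsto_entranceTime_div_sq hπ
  refine ⟨?_, ?_, ?_, Shuttle.isAsymptoticallyNormal_exitCount hπ,
    Shuttle.isAsymptoticallyNormal_entranceCount hπ⟩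
  · filter_upwards [hS, hT] with ω h1 h2 t
    exact ⟨Shuttle.finite_setOf_le_of_tendsto_atTop (Shuttle.tendsto_atTop_of_tendsto_div_sq h1) t,
      Shuttle.finite_setOf_le_of_tendsto_atTop (Shuttle.tendsto_atTop_of_tendsto_div_sq h2) t⟩
  · exact hS.mono fun ω h => Shuttle.lastIndex_isEquivalent h
  · exact hT.mono fun ω h => Shuttle.lastIndex_isEquivalent h
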